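/- Let $K$ be an algebraically closed field of characteristic $0$ (for instance $\overline{\mathbb Q}$, or an algebraic closure of $\mathbb Q(r,s,u)$ with $r,s,u$ indeterminates), let $r,s,u\in K$, and suppose that the plane quartic $$X_4:\quad x^4+y^4+z^4+rx^2y^2+sy^2z^2+uz^2x^2=0$$ in $\mathbb P^2_K$ is smooth. A line is called a bitangent of $X_4$ if it is not contained in $X_4$ and the restriction of the quartic form to the line is the square of a binary quadratic form. Then $X_4$ has exactly $28$ bitangents, and all of them are solvable by radicals: each has an equation $ax+by+cz=0$ whose coefficients $a,b,c$ are expressible by radicals over $\mathbb Q(r,s,u)$. More precisely: 1. Exactly $24$ bitangents have an equation $ax+by+z=0$. 2. Exactly four bitangents are of the form $by+z=0$; they are given by the roots of the even quartic $(u^2-4)b^4+(2ru-4s)b^2+(r^2-4)=0$, where $u^2\neq4$. 3. Exactly four bitangents are of the form $ax+z=0$; they are given by the roots of the even quartic $(s^2-4)a^4+(2rs-4u)a^2+(r^2-4)=0$, where $s^2\neq 4$. 4. Exactly four bitangents are of the form $x+by=0$; they are given by the roots of the even quartic $(u^2-4)b^4+(2su-4r)b^2+(s^2-4)=0$. 5.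 Exactly $16$ bitangents are of the form $ax+by+z=0$ with $a\ne0$ and $b\neq 0$. Put $D=4-r^2-s^2-u^2+rsu$, $E=rs^2u+4ru-2su^2-2r^2s$ and $F=6rsu-s^2u^2-r^2s^2-2r^2+2s^2-2u^2-8$. Then $D\neq0$, and the values of $b$ that occur are exactly the roots of the even polynomial of degree $8$ $$D\,b^8+E\,b^6+F\,b^4+E\,b^2+D=0,$$ a quartic equation in $b^2$. Each of the $16$ bitangents satisfies $$(s^2-4)(rb^2-u)\,a^2+(s^2+u^2-r^2-4)b^4+(su^2-r^2s)b^2+(u^2-r^2-s^2+4)=0 .$$ If $b$ is a root of the degree $8$ equation with $rb^2\ne u$, the values of $a\neq 0$ for which $ax+by+z=0$ is a bitangent are exactly the roots of this quadratic equation, and there are two of them. If $r^2\neq u^2$ and $r^2+s^2+u^2+rsu\neq4$, then the degree $8$ equation has exactly $8$ roots $b$, all with $rb^2\neq u$. -/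

import Mathlib

open scoped LinearAlgebra.Projectivization

noncomputable section

namespace PlaneQuartic

variable {K : Type*} [Field K]

/-- The quartic form `x^4 + y^4 + z^4 + r x^2 y^2 + s y^2 z^2 + u z^2 x^2`,
with `x, y, z` the variables numbered `0, 1, 2`. -/
def quarticX4 (r s u : K) : MvPolynomial (Fin 3) K :=
  MvPolynomial.X 0 ^ 4 + MvPolynomial.X 1 ^ 4 + MvPolynomial.X 2 ^ 4
    + MvPolynomial.C r * MvPolynomial.X 0 ^ 2 * MvPolynomial.X 1 ^ 2
    + MvPolynomial.C s * MvPolynomial.X 1 ^ 2 * MvPolynomial.X 2 ^ 2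
    + MvPolynomial.C u * MvPolynomial.X 2 ^ 2 * MvPolynomial.X 0 ^ 2

/-- The plane curve `f = 0` is smooth (Jacobian criterion, at the points with coordinates in the
ground field, which will be algebraically closed). -/
def IsSmoothCurve (f : MvPolynomial (Fin 3) K) : Prop :=
  ∀ p : Fin 3 → K, p ≠ 0 → MvPolynomial.eval p f = 0 →
    ∃ i, MvPolynomial.eval p (MvPolynomial.pderiv i f) ≠ 0

/-- The linear form `a x + b y + c z` with coefficient vector `v = (a, b, c)`. -/
def lineForm (v : Fin 3 → K) : MvPolynomial (Fin 3) K :=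
  ∑ i, MvPolynomial.C (v i) * MvPolynomial.X i

/-- The line with coefficient vector `v` is a bitangent of the quartic `f = 0`: it is not a
component of the curve, and the restriction of `f` to the line is the square of a binary quadratic
form, i.e. the line cuts out a divisor `2 p₁ + 2 p₂` (with `p₁ = p₂` allowed). -/
def IsBitangent (f : MvPolynomial (Fin 3) K) (v : Fin 3 → K) : Prop :=
  v ≠ 0 ∧ ¬ lineForm v ∣ f ∧
    ∃ q : MvPolynomial (Fin 3) K, q.IsHomogeneous 2 ∧ lineForm v ∣ f - q ^ 2

/-- The set of bitangent lines of `f = 0`, as points of the dual projective plane. -/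
def bitangents (f : MvPolynomial (Fin 3) K) : Set (ℙ K (Fin 3 → K)) :=
  {L | ∃ v : Fin 3 → K, ∃ h : IsBitangent f v, L = Projectivization.mk K v h.1}

/-- The elements of `K` that are expressible by radicals over the field `ℚ(r, s, u)`: the smallest
subfield of `K` containing `r, s, u` and closed under taking `n`-th roots in `K`. -/
def radicalField [CharZero K] (r s u : K) :
    IntermediateField (IntermediateField.adjoin ℚ ({r, s, u} : Set K)) K :=
  solvableByRad (IntermediateField.adjoin ℚ ({r, s, u} : Set K)) K

/-- A quartic polynomial in `B`. With `B = b^2` it is an even polynomial of degree `8` in `b`. -/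
def bQuartic (r s u B : K) : K :=
  (4 - r ^ 2 - s ^ 2 - u ^ 2 + r * s * u) * B ^ 4
    + (-2 * s * u ^ 2 + r * s ^ 2 * u + 4 * r * u - 2 * r ^ 2 * s) * B ^ 3
    + (-s ^ 2 * u ^ 2 - 2 * u ^ 2 + 6 * r * s * u - r ^ 2 * s ^ 2 + 2 * s ^ 2 - 2 * r ^ 2 - 8) * B ^ 2
    + (-2 * s * u ^ 2 + r * s ^ 2 * u + 4 * r * u - 2 * r ^ 2 * s) * B
    + (4 - r ^ 2 - s ^ 2 - u ^ 2 + r * s * u)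

/-- For fixed `b`, a quadratic polynomial in `a`. -/
def aQuadratic (r s u b a : K) : K :=
  (s ^ 2 - 4) * (r * b ^ 2 - u) * a ^ 2
    + ((s ^ 2 + u ^ 2 - r ^ 2 - 4) * b ^ 4 + (s * u ^ 2 - r ^ 2 * s) * b ^ 2
      + (u ^ 2 - r ^ 2 - s ^ 2 + 4))

end PlaneQuartic

end

/-! The quartic is the pullback of the conic `X² + Y² + Z² + rXY + sYZ + uZX = 0` under `(x, y, z) ↦
(x², y², z²)`. Smoothness yields `r², s², u² ≠ 4` and `D ≠ 0`, where `2D` is the determinant of the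
matrix of the conic with diagonal entries 2 (`nondegenerate_of_isSmoothCurve`). A line is a
bitangent exactly when the quartic restricted to it is `(p x² + m x y + n y²)²`, and comparing
coefficients gives five equations.

If one coefficient of the line vanishes, the restriction is even and the condition is the vanishing
of a discriminant. This is an even quartic whose own discriminant is a nonzero multiple of `D`, so
each of the three families has 4 members.

If `a b ≠ 0`, the equations are solved by trigonometry. Write `r = 2 cos R`, `s = 2 cos S`, `u = 2
cos U`, with `γ`, `α`, `β` the corresponding `2 sin`, so that choosing the square roots amounts to
choosing the signs of the angles. Then `a² = sin((R+U-S)/2) / sin((S+U-R)/2)` and `b² =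
sin((R+S-U)/2) / sin((S+U-R)/2)`; multiplying numerator and denominator by `-8 sin((R+S+U)/2)` gives
the equations of `IsTangentPair`. All this is carried out as polynomial identities
(`IsSquareRestriction.isTangentPair` and its converse `IsTangentPair.exists_isSquareRestriction`).

Only the products of the three roots enter, so the 8 sign choices give 4 pairs `(a², b²)`
(`exists_finset_isTangentPair`). They are distinct and have nonzero entries, hence 16 bitangents,
and `16 + 4 + 4 + 4 = 28`. Everything is built from iterated square roots, hence radical.

The polynomial in `b²` is a norm over the sign choices (`bQuartic_eq_prod`), and `a²` is determined
by `b²` unless `r b² = u`, a case excluded generically by another norm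
(`IsTangentPair.mul_sub_ne_zero`). -/

namespace PlaneQuartic

/-! ### Identities between the square roots and the squared coefficients -/

section Algebra

variable {K : Type*} [Field K]

/-- The squares `A = a ^ 2`, `B = b ^ 2` of the coefficients of a line `a x + b y + z = 0` that are
attached to a choice of square roots of `4 - s ^ 2`, `4 - u ^ 2` and `4 - r ^ 2`. -/
def IsTangentPair (r s u A B : K) : Prop :=
  ∃ α β γ : K, α ^ 2 = 4 - s ^ 2 ∧ β ^ 2 = 4 - u ^ 2 ∧ γ ^ 2 = 4 - r ^ 2 ∧
    A * (u * s - 2 * r - α * β) = r * u - 2 * s - β * γ ∧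
    B * (u * s - 2 * r - α * β) = r * s - 2 * u - α * γ

theorem sub_mul_ne_zero [CharZero K] {r s u α β : K}
    (hα : α ^ 2 = 4 - s ^ 2) (hβ : β ^ 2 = 4 - u ^ 2)
    (hD : 4 - r ^ 2 - s ^ 2 - u ^ 2 + r * s * u ≠ 0) : u * s - 2 * r - α * β ≠ 0 := by
  intro h
  apply hD
  have : (u * s - 2 * r - α * β) * (u * s - 2 * r + α * β)
      = -4 * (4 - r ^ 2 - s ^ 2 - u ^ 2 + r * s * u) := by grind -verbose
  rw [h, zero_mul] at this
  linear_combination this / 4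

/-- The equation for `B` involves only `α β` and `α γ`, whose signs vary independently; the product
over the four choices is therefore rational in `r, s, u`. -/
theorem bQuartic_eq_prod {r s u t α β γ : K}
    (hα : α ^ 2 = 4 - s ^ 2) (hβ : β ^ 2 = 4 - u ^ 2) (hγ : γ ^ 2 = 4 - r ^ 2) :
    (t * (u * s - 2 * r - α * β) - (r * s - 2 * u - α * γ))
      * (t * (u * s - 2 * r - α * β) - (r * s - 2 * u + α * γ))
      * (t * (u * s - 2 * r + α * β) - (r * s - 2 * u - α * γ))
      * (t * (u * s - 2 * r + α * β) - (r * s - 2 * u + α * γ))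
      = 16 * (4 - r ^ 2 - s ^ 2 - u ^ 2 + r * s * u) * bQuartic r s u t := by
  obtain ⟨e, he⟩ : ∃ e, e = α * γ := ⟨_, rfl⟩
  obtain ⟨e', he'⟩ : ∃ e, e = α * β := ⟨_, rfl⟩
  have h : e ^ 2 = (4 - s ^ 2) * (4 - r ^ 2) := by rw [he, mul_pow, hα, hγ]
  have h' : e' ^ 2 = (4 - s ^ 2) * (4 - u ^ 2) := by rw [he', mul_pow, hα, hβ]
  rw [← he, ← he']
  clear he he' hα hβ hγ
  unfold bQuartic
  grind -verbose

/-- This and the next four-line identities feed the converse direction. The last factor is `8 - 8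
cos(R+S+U) = 16 sin²((R+S+U)/2)`, so over an algebraically closed field the `x⁴` coefficient is
visibly a square. -/
theorem sq_add_mul_add_sq_eq {r s u α β γ : K}
    (hα : α ^ 2 = 4 - s ^ 2) (hβ : β ^ 2 = 4 - u ^ 2) (hγ : γ ^ 2 = 4 - r ^ 2) :
    (r * u - 2 * s - β * γ) ^ 2 + u * (r * u - 2 * s - β * γ) * (u * s - 2 * r - α * β)
      + (u * s - 2 * r - α * β) ^ 2
      = β ^ 2 * (8 - r * s * u + r * α * β + s * β * γ + u * α * γ) := by
  grind -verbose

/-- The second factor is the first with `γ` negated. The identity shows that the first factor is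
nonzero as soon as the denominator `u s - 2 r - α β` is. -/
theorem mul_conj_eq {r s u α β γ : K}
    (hα : α ^ 2 = 4 - s ^ 2) (hβ : β ^ 2 = 4 - u ^ 2) (hγ : γ ^ 2 = 4 - r ^ 2) :
    (8 - r * s * u + r * α * β + s * β * γ + u * α * γ)
      * (8 - r * s * u + r * α * β - s * β * γ - u * α * γ)
      = 4 * (u * s - 2 * r - α * β) ^ 2 := by
  grind -verbose

theorem mixed_coeff_eq [CharZero K] {r s u α β γ : K}
    (hα : α ^ 2 = 4 - s ^ 2) (hβ : β ^ 2 = 4 - u ^ 2) (hγ : γ ^ 2 = 4 - r ^ 2) :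
    2 * α * β * (8 - r * s * u + r * α * β + s * β * γ + u * α * γ)
      + (r * u - 2 * s - β * γ) * (r * s - 2 * u - α * γ)
        * (8 + r * s * u - r * α * β + s * β * γ + u * α * γ) / 4
      = r * (u * s - 2 * r - α * β) ^ 2
        + s * (r * u - 2 * s - β * γ) * (u * s - 2 * r - α * β)
        + u * (r * s - 2 * u - α * γ) * (u * s - 2 * r - α * β)
        + 6 * (r * u - 2 * s - β * γ) * (r * s - 2 * u - α * γ) := by
  grind -verbose

/-- In angles, `α u + s β + 2 γ = 8 sin((R+S+U)/2) cos((S+U-R)/2)`, and the right side is the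
product of `16 sin²` and `4 cos²` of these half angles. -/
theorem sq_double_coeff_eq [CharZero K] {r s u α β γ : K}
    (hα : α ^ 2 = 4 - s ^ 2) (hβ : β ^ 2 = 4 - u ^ 2) (hγ : γ ^ 2 = 4 - r ^ 2) :
    (α * u + s * β + 2 * γ) ^ 2
      = (8 - r * s * u + r * α * β + s * β * γ + u * α * γ)
        * ((8 + r * s * u - r * α * β + s * β * γ + u * α * γ) / 4) := by
  grind -verbose

theorem double_coeff_eq {r s u α β γ : K}
    (hα : α ^ 2 = 4 - s ^ 2) (hβ : β ^ 2 = 4 - u ^ 2) :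
    u * (u * s - 2 * r - α * β) + 2 * (r * u - 2 * s - β * γ)
      = -β * (α * u + s * β + 2 * γ) ∧
    s * (u * s - 2 * r - α * β) + 2 * (r * s - 2 * u - α * γ)
      = -α * (α * u + s * β + 2 * γ) := by
  constructor <;> grind -verbose

/-- After multiplication by the square of the common denominator, this is a polynomial identity
modulo the three square-root relations. -/
theorem aQuadratic_eq_zero_of_isTangentPair [CharZero K] {r s u a b : K}
    (hD : 4 - r ^ 2 - s ^ 2 - u ^ 2 + r * s * u ≠ 0) (h : IsTangentPair r s u (a ^ 2) (b ^ 2)) :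
    aQuadratic r s u b a = 0 := by
  obtain ⟨α, β, γ, hα, hβ, hγ, hA, hB⟩ := h
  have hC := sub_mul_ne_zero hα hβ hD
  have : (s ^ 2 - 4) * (r * (r * s - 2 * u - α * γ) - u * (u * s - 2 * r - α * β))
        * (r * u - 2 * s - β * γ)
      + ((s ^ 2 + u ^ 2 - r ^ 2 - 4) * (r * s - 2 * u - α * γ) ^ 2
        + (s * u ^ 2 - r ^ 2 * s) * (r * s - 2 * u - α * γ) * (u * s - 2 * r - α * β)
        + (u ^ 2 - r ^ 2 - s ^ 2 + 4) * (u * s - 2 * r - α * β) ^ 2) = 0 := by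
    clear hA hB hC
    grind -verbose
  rw [← hA, ← hB] at this
  apply mul_left_cancel₀ (pow_ne_zero 2 hC)
  unfold aQuadratic
  linear_combination this

/-- Here `μ = 2 cos θ`, `ν = 2 sin θ`, and `hr`, `hγ` say `r = 2 cos(S+U-2θ)`, `γ = 2 sin(S+U-2θ)`.
So `θ = (S+U-R)/2` up to periods and `A = sin(U-θ) / sin θ`. Stated for `A` alone; exchanging `s, α,
n` with `u, β, p` gives the formula for `B`. -/
theorem tangency_of_half_angle [CharZero K] {r s u A p n α β γ μ ν : K}
    (hα : α ^ 2 = 4 - s ^ 2) (hβ : β ^ 2 = 4 - u ^ 2) (hν : μ ^ 2 + ν ^ 2 = 4)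
    (hp : p * ν = β) (hn : n * ν = α) (hA : 2 * A = p * μ - u)
    (hr : 4 * r = (u * s - α * β) * (μ ^ 2 - 2) + μ * ν * (s * β + u * α))
    (hγ : 4 * γ = (s * β + u * α) * (μ ^ 2 - 2) - μ * ν * (u * s - α * β)) :
    γ ^ 2 = 4 - r ^ 2 ∧ A * (u * s - 2 * r - α * β) = r * u - 2 * s - β * γ := by
  refine ⟨by grind -verbose, ?_⟩
  subst hp hn
  obtain rfl : r = ((u * s - n * ν * (p * ν)) * (μ ^ 2 - 2)
      + μ * ν * (s * (p * ν) + u * (n * ν))) / 4 := by linear_combination hr / 4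
  obtain rfl : γ = ((s * (p * ν) + u * (n * ν)) * (μ ^ 2 - 2)
      - μ * ν * (u * s - n * ν * (p * ν))) / 4 := by linear_combination hγ / 4
  obtain rfl : A = (p * μ - u) / 2 := by linear_combination hA / 2
  grind -verbose

/-- The coefficients of the restriction of the quartic to `a x + b y + z = 0` are those of
`(p x ^ 2 + m x y + n y ^ 2) ^ 2`. -/
def IsSquareRestriction (r s u a b p m n : K) : Prop :=
  p ^ 2 = 1 + u * a ^ 2 + a ^ 4 ∧ p * m = a * b * (u + 2 * a ^ 2) ∧
    2 * p * n + m ^ 2 = r + s * a ^ 2 + u * b ^ 2 + 6 * a ^ 2 * b ^ 2 ∧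
    m * n = a * b * (s + 2 * b ^ 2) ∧ n ^ 2 = 1 + s * b ^ 2 + b ^ 4

theorem IsSquareRestriction.isTangentPair [CharZero K] [IsAlgClosed K] {r s u a b p m n : K}
    (ha : a ≠ 0) (hb : b ≠ 0)
    (h : IsSquareRestriction r s u a b p m n) : IsTangentPair r s u (a ^ 2) (b ^ 2) := by
  obtain ⟨h4, h3, h2, h1, h0⟩ := h
  have hab : a * b ≠ 0 := mul_ne_zero ha hb
  obtain ⟨μ, rfl⟩ : ∃ μ, m = a * b * μ := ⟨m / (a * b), by field_simp⟩
  replace h3 : p * μ = u + 2 * a ^ 2 := by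
    apply mul_left_cancel₀ hab; linear_combination h3
  replace h1 : μ * n = s + 2 * b ^ 2 := by
    apply mul_left_cancel₀ hab; linear_combination h1
  -- `ν` is the sine belonging to the cosine `μ`. Scaling by it turns `p` and `n` into square roots
  -- of `4 - u²` and `4 - s²`, because `(u + 2a²)² - 4(1 + u a² + a⁴) = u² - 4`.
  obtain ⟨ν, hν⟩ := IsAlgClosed.exists_pow_nat_eq (4 - μ ^ 2) two_pos
  have hβ : (p * ν) ^ 2 = 4 - u ^ 2 := by
    linear_combination p ^ 2 * hν + 4 * h4 - (p * μ + u + 2 * a ^ 2) * h3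
  have hα : (n * ν) ^ 2 = 4 - s ^ 2 := by
    linear_combination n ^ 2 * hν + 4 * h0 - (n * μ + s + 2 * b ^ 2) * h1
  have hA : 2 * a ^ 2 = p * μ - u := by linear_combination -h3
  have hB : 2 * b ^ 2 = n * μ - s := by linear_combination -h1
  have hν' : μ ^ 2 + ν ^ 2 = 4 := by linear_combination hν
  -- With `A` and `B` eliminated, the `x² y²` coefficient becomes the addition formula for
  -- `cos(S+U-2θ)`.
  have hr : 4 * r = (u * s - n * ν * (p * ν)) * (μ ^ 2 - 2)
      + μ * ν * (s * (p * ν) + u * (n * ν)) := by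
    obtain ⟨A, hA'⟩ : ∃ A, A = a ^ 2 := ⟨_, rfl⟩
    obtain ⟨B, hB'⟩ : ∃ B, B = b ^ 2 := ⟨_, rfl⟩
    have h2' : 2 * p * n + A * B * μ ^ 2 = r + s * A + u * B + 6 * A * B := by
      rw [hA', hB']; linear_combination h2
    rw [← hA'] at hA
    rw [← hB'] at hB
    clear h2 h1 h3 h4 h0 hA' hB' hα hβ hν
    obtain rfl : A = (p * μ - u) / 2 := by linear_combination hA / 2
    obtain rfl : B = (n * μ - s) / 2 := by linear_combination hB / 2
    obtain rfl : r = 2 * p * n + (p * μ - u) / 2 * ((n * μ - s) / 2) * μ ^ 2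
      - s * ((p * μ - u) / 2) - u * ((n * μ - s) / 2)
      - 6 * ((p * μ - u) / 2) * ((n * μ - s) / 2) := by linear_combination -h2'
    grind -verbose
  obtain ⟨γ, hγ⟩ : ∃ γ, 4 * γ = (s * (p * ν) + u * (n * ν)) * (μ ^ 2 - 2)
      - μ * ν * (u * s - n * ν * (p * ν)) :=
    ⟨((s * (p * ν) + u * (n * ν)) * (μ ^ 2 - 2) - μ * ν * (u * s - n * ν * (p * ν))) / 4, by ring⟩
  obtain ⟨hγ', hA'⟩ := tangency_of_half_angle hα hβ hν' rfl rfl hA hr hγ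
  obtain ⟨-, hB'⟩ := tangency_of_half_angle (r := r) (γ := γ) hβ hα hν' rfl rfl hB
    (by linear_combination hr) (by linear_combination hγ)
  exact ⟨n * ν, p * ν, γ, hα, hβ, hγ', hA', by linear_combination hB'⟩

theorem IsTangentPair.exists_isSquareRestriction [CharZero K] [IsAlgClosed K] {r s u a b : K}
    (hD : 4 - r ^ 2 - s ^ 2 - u ^ 2 + r * s * u ≠ 0)
    (h : IsTangentPair r s u (a ^ 2) (b ^ 2)) :
    ∃ p m n, IsSquareRestriction r s u a b p m n := by
  obtain ⟨α, β, γ, hα, hβ, hγ, hA, hB⟩ := h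
  have hC := sub_mul_ne_zero hα hβ hD
  have e4 := sq_add_mul_add_sq_eq hα hβ hγ
  have e0 := sq_add_mul_add_sq_eq hβ hα hγ (r := r)
  have e2 := mixed_coeff_eq hα hβ hγ
  have eG := sq_double_coeff_eq hα hβ hγ
  have eW := mul_conj_eq hα hβ hγ
  obtain ⟨e3, e1⟩ := double_coeff_eq (r := r) (γ := γ) hα hβ
  rw [show s * u - 2 * r - β * α = u * s - 2 * r - α * β by ring] at e0
  rw [← hA] at e2 e3 e4
  rw [← hB] at e2 e1 e0
  rw [show 8 - r * u * s + r * β * α + u * α * γ + s * β * γ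
    = 8 - r * s * u + r * α * β + s * β * γ + u * α * γ by ring] at e0
  have e2' : 2 * α * β * (8 - r * s * u + r * α * β + s * β * γ + u * α * γ)
      + a ^ 2 * (u * s - 2 * r - α * β) * (b ^ 2 * (u * s - 2 * r - α * β))
        * ((8 + r * s * u - r * α * β + s * β * γ + u * α * γ) / 4) = _ :=
    (by ring : _ = _).trans e2
  clear e2 hA hB hα hβ hγ hD
  generalize u * s - 2 * r - α * β = c at *
  generalize α * u + s * β + 2 * γ = G at *
  generalize (8 + r * s * u - r * α * β + s * β * γ + u * α * γ) / 4 = M at *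
  -- `w` stands for `4 sin((R+S+U)/2)`; the outer coefficients force `p = β w / c` and `n = α w / c`
  -- up to sign, and `e3` then dictates `m`.
  obtain ⟨w, hw⟩ := IsAlgClosed.exists_pow_nat_eq
    (8 - r * s * u + r * α * β + s * β * γ + u * α * γ) two_pos
  rw [← hw] at e0 e4 eG e2' eW
  have hw0 : w ≠ 0 := by
    rintro rfl
    apply pow_ne_zero 2 hC
    linear_combination -eW / 4
  have hM : M = G ^ 2 / w ^ 2 := by field_simp; linear_combination -eG
  subst hM
  clear hw eW eG
  refine ⟨β * w / c, -(a * b * G) / w, α * w / c, ?_, ?_, ?_, ?_, ?_⟩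
  · field_simp
    linear_combination -e4
  · field_simp
    linear_combination -(a * b) * e3
  · field_simp at e2' ⊢
    linear_combination e2'
  · field_simp
    linear_combination -(a * b) * e1
  · field_simp
    linear_combination -e0

end Algebra

/-! ### From bitangents to coefficient equations, chart by chart -/

section Charts

variable {K : Type*} [Field K]

/-- Each partial derivative is twice a variable times a linear form in the squares. A nonzero
solution `(X, Y, Z)` of the system in `key` therefore yields a singular point by taking square roots
of its coordinates. -/
theorem nondegenerate_of_isSmoothCurve [CharZero K] [IsAlgClosed K] {r s u : K}
    (h : IsSmoothCurve (quarticX4 r s u)) :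
    r ^ 2 - 4 ≠ 0 ∧ s ^ 2 - 4 ≠ 0 ∧ u ^ 2 - 4 ≠ 0 ∧
      4 - r ^ 2 - s ^ 2 - u ^ 2 + r * s * u ≠ 0 := by
  have key (X Y Z : K) (hne : X ≠ 0 ∨ Y ≠ 0 ∨ Z ≠ 0)
      (hX : X * (2 * X + r * Y + u * Z) = 0) (hY : Y * (r * X + 2 * Y + s * Z) = 0)
      (hZ : Z * (u * X + s * Y + 2 * Z) = 0) : False := by
    obtain ⟨x, rfl⟩ := IsAlgClosed.exists_pow_nat_eq X two_pos
    obtain ⟨y, rfl⟩ := IsAlgClosed.exists_pow_nat_eq Y two_pos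
    obtain ⟨z, rfl⟩ := IsAlgClosed.exists_pow_nat_eq Z two_pos
    have e1 : x * (2 * x ^ 2 + r * y ^ 2 + u * z ^ 2) = 0 := by
      rcases mul_eq_zero.1 hX with h | h
      · rw [pow_eq_zero_iff two_ne_zero] at h; simp [h]
      · simp [h]
    have e2 : y * (r * x ^ 2 + 2 * y ^ 2 + s * z ^ 2) = 0 := by
      rcases mul_eq_zero.1 hY with h | h
      · rw [pow_eq_zero_iff two_ne_zero] at h; simp [h]
      · simp [h]
    have e3 : z * (u * x ^ 2 + s * y ^ 2 + 2 * z ^ 2) = 0 := by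
      rcases mul_eq_zero.1 hZ with h | h
      · rw [pow_eq_zero_iff two_ne_zero] at h; simp [h]
      · simp [h]
    obtain ⟨i, hi⟩ := h ![x, y, z]
      (by rintro h0
          have h0' := congrFun h0 0
          have h1' := congrFun h0 1
          have h2' := congrFun h0 2
          simp at h0' h1' h2'
          simp [h0', h1', h2'] at hne)
      (by simp [quarticX4]; linear_combination (x * e1 + y * e2 + z * e3) / 2)
    apply hi
    fin_cases i
    · simp [quarticX4, MvPolynomial.pderiv_X]
      linear_combination 2 * e1
    · simp [quarticX4, MvPolynomial.pderiv_X]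
      linear_combination 2 * e2
    · simp [quarticX4, MvPolynomial.pderiv_X]
      linear_combination 2 * e3
  have two : (-2 : K) ≠ 0 := by simp
  refine ⟨fun h0 ↦ ?_, fun h0 ↦ ?_, fun h0 ↦ ?_, fun h0 ↦ ?_⟩
  -- If `r² = 4`, the conic meets `Z = 0` in the double point `(r, -2, 0)`; the next two cases are
  -- the analogues on the other axes.
  · exact key r (-2) 0 (by simp) (by ring) (by linear_combination -2 * h0) (by ring)
  · exact key 0 s (-2) (by simp) (by ring) (by ring) (by linear_combination -2 * h0)
  · exact key u 0 (-2) (by simp) (by ring) (by ring) (by linear_combination -2 * h0)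
  · obtain ⟨v, hv, hMv⟩ := Matrix.exists_mulVec_eq_zero_iff.2
      (show (!![2, r, u; r, 2, s; u, s, 2] : Matrix (Fin 3) (Fin 3) K).det = 0 by
        rw [Matrix.det_fin_three]; simp; linear_combination 2 * h0)
    have e0 := congrFun hMv 0
    have e1 := congrFun hMv 1
    have e2 := congrFun hMv 2
    simp [Matrix.mulVec, dotProduct, Fin.sum_univ_three] at e0 e1 e2
    refine key (v 0) (v 1) (v 2) ?_ (by rw [e0, mul_zero]) (by rw [e1, mul_zero])
      (by rw [e2, mul_zero])
    by_contra! hc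
    exact hv (funext fun i ↦ by fin_cases i <;> simp [hc])

open Polynomial in
theorem IsBitangent.exists_aeval_eq_sq {f : MvPolynomial (Fin 3) K} {v : Fin 3 → K}
    (h : IsBitangent f v) (φ : Fin 3 → K[X]) (hdeg : ∀ i, (φ i).natDegree ≤ 1)
    (hφ : MvPolynomial.aeval φ (lineForm v) = 0) :
    ∃ p m n : K, MvPolynomial.aeval φ f = (C p * X ^ 2 + C m * X + C n) ^ 2 := by
  obtain ⟨-, -, q, hq, g, hg⟩ := h
  have h1 := MvPolynomial.aeval_natDegree_le q hq.totalDegree_le φ hdeg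
  have h2 := congrArg (MvPolynomial.aeval φ) hg
  rw [map_sub, map_pow, map_mul, hφ, zero_mul, sub_eq_zero] at h2
  refine ⟨_, _, _, h2.trans (congrArg (· ^ 2)
    (Polynomial.eq_quadratic_of_degree_le_two (natDegree_le_iff_degree_le.1 h1)))⟩

open Polynomial in
theorem not_lineForm_dvd {f : MvPolynomial (Fin 3) K} {v : Fin 3 → K} (φ : Fin 3 → K[X])
    (hφ : MvPolynomial.aeval φ (lineForm v) = 0) (hf : MvPolynomial.aeval φ f ≠ 0) :
    ¬ lineForm v ∣ f := by
  rintro ⟨g, rfl⟩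
  rw [map_mul, hφ, zero_mul] at hf
  exact hf rfl

open Polynomial in
theorem quartic_coeffs_eq {c₄ c₃ c₂ c₁ c₀ d₄ d₃ d₂ d₁ d₀ : K}
    (h : C c₄ * X ^ 4 + C c₃ * X ^ 3 + C c₂ * X ^ 2 + C c₁ * X + C c₀
      = C d₄ * X ^ 4 + C d₃ * X ^ 3 + C d₂ * X ^ 2 + C d₁ * X + C d₀) :
    c₄ = d₄ ∧ c₃ = d₃ ∧ c₂ = d₂ ∧ c₁ = d₁ ∧ c₀ = d₀ := by
  have (i : ℕ) := congrArg (fun q : K[X] ↦ q.coeff i) h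
  refine ⟨?_, ?_, ?_, ?_, ?_⟩
  · simpa [coeff_X, coeff_C, coeff_X_pow] using this 4
  · simpa [coeff_X, coeff_C, coeff_X_pow] using this 3
  · simpa [coeff_X, coeff_C, coeff_X_pow] using this 2
  · simpa [coeff_X, coeff_C, coeff_X_pow] using this 1
  · simpa [coeff_X, coeff_C, coeff_X_pow] using this 0

open Polynomial in
theorem quadratic_sq (p m n : K) :
    (C p * X ^ 2 + C m * X + C n) ^ 2 = C (p ^ 2) * X ^ 4 + C (2 * p * m) * X ^ 3
      + C (2 * p * n + m ^ 2) * X ^ 2 + C (2 * m * n) * X + C (n ^ 2) := by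
  simp only [map_mul, map_add, map_pow, map_ofNat]
  ring

theorem isHomogeneous_two {p m n : K} (i j : Fin 3) :
    (MvPolynomial.C p * MvPolynomial.X i ^ 2
      + MvPolynomial.C m * (MvPolynomial.X i * MvPolynomial.X j)
      + MvPolynomial.C n * MvPolynomial.X j ^ 2 : MvPolynomial (Fin 3) K).IsHomogeneous 2 := by
  have h (c : K) (i j : Fin 3) : (MvPolynomial.C c * (MvPolynomial.X i * MvPolynomial.X j) :
      MvPolynomial (Fin 3) K).IsHomogeneous 2 := by
    simpa using (MvPolynomial.isHomogeneous_C _ c).mul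
      ((MvPolynomial.isHomogeneous_X K i).mul (MvPolynomial.isHomogeneous_X K j))
  simp only [pow_two]
  exact ((h _ _ _).add (h _ _ _)).add (h _ _ _)

open Polynomial in
theorem isBitangent_iff_isSquareRestriction [CharZero K] {r s u a b : K} (hu : u ^ 2 - 4 ≠ 0) :
    IsBitangent (quarticX4 r s u) ![a, b, 1] ↔
      ∃ p m n, IsSquareRestriction r s u a b p m n := by
  -- The line `z = -(a x + b y)` is parametrized affinely by `y = 1`.
  have hφ : MvPolynomial.aeval (![X, 1, -(C a * X + C b)] : Fin 3 → K[X])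
      (lineForm ![a, b, 1]) = 0 := by
    simp [lineForm, Fin.sum_univ_three]
  have hF : MvPolynomial.aeval (![X, 1, -(C a * X + C b)] : Fin 3 → K[X]) (quarticX4 r s u)
      = C (1 + u * a ^ 2 + a ^ 4) * X ^ 4 + C (2 * (a * b * (u + 2 * a ^ 2))) * X ^ 3
        + C (r + s * a ^ 2 + u * b ^ 2 + 6 * a ^ 2 * b ^ 2) * X ^ 2
        + C (2 * (a * b * (s + 2 * b ^ 2))) * X + C (1 + s * b ^ 2 + b ^ 4) := by
    simp [quarticX4]
    have h2 : (C 2 : K[X]) = 2 := map_ofNat C 2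
    have h6 : (C 6 : K[X]) = 6 := map_ofNat C 6
    rw [h2, h6]
    ring
  constructor
  · intro h
    obtain ⟨p, m, n, hpmn⟩ := h.exists_aeval_eq_sq _ (by
      intro i
      fin_cases i
      · simp
      · simp
      · simp; compute_degree) hφ
    rw [hF, quadratic_sq] at hpmn
    obtain ⟨h4, h3, h2, h1, h0⟩ := quartic_coeffs_eq hpmn
    exact ⟨p, m, n, h4.symm, by linear_combination -h3 / 2, h2.symm,
      by linear_combination -h1 / 2, h0.symm⟩
  · rintro ⟨p, m, n, h4, h3, h2, h1, h0⟩
    refine ⟨fun h ↦ by simpa using congrFun h 2, not_lineForm_dvd _ hφ ?_, _,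
      isHomogeneous_two (p := p) (m := m) (n := n) 0 1, ?_⟩
    · rw [hF]
      intro h
      obtain ⟨h4, h3, h2, h1, h0⟩ := quartic_coeffs_eq (h.trans
        (show (0 : K[X]) = C 0 * X ^ 4 + C 0 * X ^ 3 + C 0 * X ^ 2 + C 0 * X + C 0 by simp))
      have ha : a ≠ 0 := by rintro rfl; simp at h4
      have hb : b ≠ 0 := by rintro rfl; simp at h0
      have h5 : u + 2 * a ^ 2 = 0 := by simpa [ha, hb] using h3
      exact hu (by linear_combination (u + 2 * a ^ 2) * h5 - 4 * h4)
    · have hq : (MvPolynomial.C p * MvPolynomial.X 0 ^ 2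
          + MvPolynomial.C m * (MvPolynomial.X 0 * MvPolynomial.X 1)
          + MvPolynomial.C n * MvPolynomial.X 1 ^ 2 : MvPolynomial (Fin 3) K) ^ 2
          = MvPolynomial.C (p ^ 2) * MvPolynomial.X 0 ^ 4
          + MvPolynomial.C (2 * (p * m)) * (MvPolynomial.X 0 ^ 3 * MvPolynomial.X 1)
          + MvPolynomial.C (2 * p * n + m ^ 2) * (MvPolynomial.X 0 ^ 2 * MvPolynomial.X 1 ^ 2)
          + MvPolynomial.C (2 * (m * n)) * (MvPolynomial.X 0 * MvPolynomial.X 1 ^ 3)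
          + MvPolynomial.C (n ^ 2) * MvPolynomial.X 1 ^ 4 := by
        simp only [map_mul, map_add, map_pow, map_ofNat]
        ring
      rw [hq, h4, h3, h2, h1, h0]
      -- With `w = a x + b y`, the cofactor comes from `f(x,y,z) - f(x,y,-w) = (z² - w²)(z² + w² + s
      -- y² + u x²)`.
      refine ⟨(MvPolynomial.X 2 - MvPolynomial.C a * MvPolynomial.X 0
        - MvPolynomial.C b * MvPolynomial.X 1) * (MvPolynomial.X 2 ^ 2
        + (MvPolynomial.C a * MvPolynomial.X 0 + MvPolynomial.C b * MvPolynomial.X 1) ^ 2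
        + MvPolynomial.C s * MvPolynomial.X 1 ^ 2 + MvPolynomial.C u * MvPolynomial.X 0 ^ 2), ?_⟩
      have h2 : (MvPolynomial.C 2 : MvPolynomial (Fin 3) K) = 2 := map_ofNat MvPolynomial.C 2
      have h6 : (MvPolynomial.C 6 : MvPolynomial (Fin 3) K) = 6 := map_ofNat MvPolynomial.C 6
      simp [quarticX4, lineForm, Fin.sum_univ_three, h2, h6]
      ring

open Polynomial in
theorem sq_eq_of_biquadratic_eq_sq [CharZero K] {c d p m n : K}
    (h : X ^ 4 + C c * X ^ 2 + C d = (C p * X ^ 2 + C m * X + C n) ^ 2) : c ^ 2 = 4 * d := by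
  rw [quadratic_sq] at h
  obtain ⟨h4, h3, h2, h1, h0⟩ := quartic_coeffs_eq ((show C 1 * X ^ 4 + C 0 * X ^ 3 + C c * X ^ 2
    + C 0 * X + C d = X ^ 4 + C c * X ^ 2 + C d by simp).trans h)
  have hp : p ≠ 0 := by rintro rfl; simp at h4
  obtain rfl : m = 0 := by simpa [hp] using h3.symm
  rw [h2, h0]
  linear_combination -4 * n ^ 2 * h4

theorem isBitangent_left_zero_iff [CharZero K] {r s u b : K} (hu : u ^ 2 - 4 ≠ 0) :
    IsBitangent (quarticX4 r s u) ![0, b, 1] ↔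
      (u ^ 2 - 4) * b ^ 4 + (2 * r * u - 4 * s) * b ^ 2 + (r ^ 2 - 4) = 0 := by
  rw [isBitangent_iff_isSquareRestriction hu]
  constructor
  · rintro ⟨p, m, n, h4, h3, h2, h1, h0⟩
    have hp : p ≠ 0 := by rintro rfl; simp at h4
    obtain rfl : m = 0 := by simpa [hp] using h3
    linear_combination -(r + u * b ^ 2 + 2 * p * n) * h2 + 4 * p ^ 2 * h0
      + 4 * (1 + s * b ^ 2 + b ^ 4) * h4
  · intro h
    exact ⟨1, 0, (r + u * b ^ 2) / 2, by ring, by ring, by ring, by ring,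
      by linear_combination h / 4⟩

theorem isBitangent_mid_zero_iff [CharZero K] {r s u a : K} (hu : u ^ 2 - 4 ≠ 0) :
    IsBitangent (quarticX4 r s u) ![a, 0, 1] ↔
      (s ^ 2 - 4) * a ^ 4 + (2 * r * s - 4 * u) * a ^ 2 + (r ^ 2 - 4) = 0 := by
  rw [isBitangent_iff_isSquareRestriction hu]
  constructor
  · rintro ⟨p, m, n, h4, h3, h2, h1, h0⟩
    have hp : n ≠ 0 := by rintro rfl; simp at h0
    obtain rfl : m = 0 := by simpa [hp] using h1
    linear_combination -(r + s * a ^ 2 + 2 * p * n) * h2 + 4 * p ^ 2 * h0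
      + 4 * h4
  · intro h
    exact ⟨(r + s * a ^ 2) / 2, 0, 1, by linear_combination h / 4, by ring, by ring, by ring,
      by ring⟩

open Polynomial in
theorem isBitangent_right_zero_iff [CharZero K] {r s u b : K} :
    IsBitangent (quarticX4 r s u) ![1, b, 0] ↔
      (u ^ 2 - 4) * b ^ 4 + (2 * s * u - 4 * r) * b ^ 2 + (s ^ 2 - 4) = 0 := by
  have hφ : MvPolynomial.aeval (![-C b, 1, X] : Fin 3 → K[X]) (lineForm ![1, b, 0]) = 0 := by
    simp [lineForm, Fin.sum_univ_three]
  have hF : MvPolynomial.aeval (![-C b, 1, X] : Fin 3 → K[X]) (quarticX4 r s u)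
      = X ^ 4 + C (s + u * b ^ 2) * X ^ 2 + C (1 + r * b ^ 2 + b ^ 4) := by
    simp [quarticX4]
    ring
  constructor
  · intro h
    obtain ⟨p, m, n, hpmn⟩ := h.exists_aeval_eq_sq _ (by
      intro i
      fin_cases i <;> simp) hφ
    rw [hF] at hpmn
    linear_combination sq_eq_of_biquadratic_eq_sq hpmn
  · intro h
    refine ⟨fun h ↦ by simpa using congrFun h 0, not_lineForm_dvd _ hφ ?_, _,
      isHomogeneous_two (p := 1) (m := 0) (n := (s + u * b ^ 2) / 2) 2 1, ?_⟩
    · rw [hF]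
      intro h
      simpa [coeff_X_pow, coeff_C, -map_add, -map_mul, -map_pow] using
        congrArg (fun q : K[X] ↦ q.coeff 4) h
    · have hq : (MvPolynomial.C 1 * MvPolynomial.X 2 ^ 2
          + MvPolynomial.C 0 * (MvPolynomial.X 2 * MvPolynomial.X 1)
          + MvPolynomial.C ((s + u * b ^ 2) / 2) * MvPolynomial.X 1 ^ 2 :
            MvPolynomial (Fin 3) K) ^ 2
          = MvPolynomial.X 2 ^ 4
          + MvPolynomial.C (2 * ((s + u * b ^ 2) / 2))
            * (MvPolynomial.X 2 ^ 2 * MvPolynomial.X 1 ^ 2)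
          + MvPolynomial.C (((s + u * b ^ 2) / 2) ^ 2) * MvPolynomial.X 1 ^ 4 := by
        simp only [map_mul, map_pow, map_ofNat, map_one, map_zero]
        ring
      rw [hq, show 2 * ((s + u * b ^ 2) / 2) = s + u * b ^ 2 by ring,
        show ((s + u * b ^ 2) / 2) ^ 2 = 1 + r * b ^ 2 + b ^ 4 by linear_combination h / 4]
      refine ⟨(MvPolynomial.X 0 - MvPolynomial.C b * MvPolynomial.X 1) * (MvPolynomial.X 0 ^ 2
        + (MvPolynomial.C b * MvPolynomial.X 1) ^ 2
        + MvPolynomial.C r * MvPolynomial.X 1 ^ 2 + MvPolynomial.C u * MvPolynomial.X 2 ^ 2), ?_⟩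
      simp [quarticX4, lineForm, Fin.sum_univ_three]
      ring

open Polynomial in
theorem not_isBitangent_y [CharZero K] {r s u : K} (hu : u ^ 2 - 4 ≠ 0) :
    ¬ IsBitangent (quarticX4 r s u) ![0, 1, 0] := by
  intro h
  obtain ⟨p, m, n, hpmn⟩ := h.exists_aeval_eq_sq ![1, 0, X] (by
    intro i
    fin_cases i <;> simp) (by simp [lineForm, Fin.sum_univ_three])
  have hF : MvPolynomial.aeval (![1, 0, X] : Fin 3 → K[X]) (quarticX4 r s u)
      = X ^ 4 + C u * X ^ 2 + C 1 := by
    simp [quarticX4]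
    ring
  rw [hF] at hpmn
  exact hu (by linear_combination sq_eq_of_biquadratic_eq_sq hpmn)

theorem IsBitangent.smul {f : MvPolynomial (Fin 3) K} {v : Fin 3 → K} (h : IsBitangent f v)
    {c : K} (hc : c ≠ 0) : IsBitangent f (c • v) := by
  have hl : Associated (lineForm v) (lineForm (c • v)) := by
    refine ⟨Units.map MvPolynomial.C.toMonoidHom (Units.mk0 c hc), ?_⟩
    simp [lineForm, Finset.sum_mul]
    exact Finset.sum_congr rfl fun i _ ↦ by ring
  obtain ⟨h0, h1, q, hq, hd⟩ := h
  exact ⟨smul_ne_zero hc h0, fun h ↦ h1 (hl.dvd_iff_dvd_left.2 h), q, hq,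
    hl.dvd_iff_dvd_left.1 hd⟩

end Charts

/-! ### Counting square roots and roots of even quartics -/

section Counting

theorem ncard_preimage_of_fiber {ι κ : Type*} (h : ι → κ) {k : ℕ} (T : Finset κ)
    (hk : ∀ t ∈ T, (h ⁻¹' {t}).Finite ∧ (h ⁻¹' {t}).ncard = k) :
    (h ⁻¹' (T : Set κ)).Finite ∧ (h ⁻¹' (T : Set κ)).ncard = T.card * k := by
  classical
  induction T using Finset.induction_on with
  | empty => simp
  | insert t T ht ih =>
    obtain ⟨ih1, ih2⟩ := ih fun t' ht' ↦ hk t' (Finset.mem_insert_of_mem ht')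
    obtain ⟨h1, h2⟩ := hk t (Finset.mem_insert_self t T)
    rw [Finset.coe_insert, Set.insert_eq, Set.preimage_union]
    refine ⟨h1.union ih1, ?_⟩
    rw [Set.ncard_union_eq _ h1 ih1, h2, ih2, Finset.card_insert_of_notMem ht]
    · ring
    · exact Disjoint.preimage h (Set.disjoint_singleton_left.2 ht)

variable {K : Type*} [Field K] [CharZero K] [IsAlgClosed K]

theorem setOf_sq_eq {A : K} (hA : A ≠ 0) :
    ({a : K | a ^ 2 = A}).Finite ∧ {a : K | a ^ 2 = A}.ncard = 2 := by
  obtain ⟨c, rfl⟩ := IsAlgClosed.exists_pow_nat_eq A two_pos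
  have hc : c ≠ 0 := by rintro rfl; simp at hA
  have : {a : K | a ^ 2 = c ^ 2} = {c, -c} := by
    ext a
    simp [sq_eq_sq_iff_eq_or_eq_neg]
  rw [this]
  refine ⟨Set.toFinite _, Set.ncard_pair fun h ↦ hc ?_⟩
  rwa [self_eq_neg] at h

theorem ncard_setOf_sq_mem {T : Finset K} (hT : 0 ∉ T) :
    {b : K | b ^ 2 ∈ T}.Finite ∧ {b : K | b ^ 2 ∈ T}.ncard = T.card * 2 :=
  ncard_preimage_of_fiber (fun b : K ↦ b ^ 2) T fun _ ht ↦
    setOf_sq_eq fun h ↦ hT (h ▸ ht)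

theorem ncard_setOf_sq_prod_mem {T : Finset (K × K)} (hT : ∀ t ∈ T, t.1 ≠ 0 ∧ t.2 ≠ 0) :
    {p : K × K | (p.1 ^ 2, p.2 ^ 2) ∈ T}.Finite ∧
      {p : K × K | (p.1 ^ 2, p.2 ^ 2) ∈ T}.ncard = T.card * 4 := by
  refine ncard_preimage_of_fiber (fun p : K × K ↦ (p.1 ^ 2, p.2 ^ 2)) T fun t ht ↦ ?_
  have h1 := setOf_sq_eq (hT t ht).1
  have h2 := setOf_sq_eq (hT t ht).2
  have : (fun p : K × K ↦ (p.1 ^ 2, p.2 ^ 2)) ⁻¹' {t}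
      = {a : K | a ^ 2 = t.1} ×ˢ {b : K | b ^ 2 = t.2} := by
    ext p
    simp [Prod.ext_iff]
  rw [this, Set.ncard_prod, h1.2, h2.2]
  exact ⟨h1.1.prod h2.1, rfl⟩

theorem ncard_setOf_even_quartic {c₂ c₁ c₀ : K} (h2 : c₂ ≠ 0) (h0 : c₀ ≠ 0)
    (hdisc : c₁ ^ 2 - 4 * c₂ * c₀ ≠ 0) :
    {b : K | c₂ * b ^ 4 + c₁ * b ^ 2 + c₀ = 0}.ncard = 4 := by
  classical
  obtain ⟨δ, hδ⟩ := IsAlgClosed.exists_pow_nat_eq (c₁ ^ 2 - 4 * c₂ * c₀) two_pos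
  have hδ0 : δ ≠ 0 := by rintro rfl; simp [← hδ] at hdisc
  have hroot (t : K) : c₂ * t ^ 2 + c₁ * t + c₀ = 0 ↔
      t = (-c₁ + δ) / (2 * c₂) ∨ t = (-c₁ - δ) / (2 * c₂) := by
    have := quadratic_eq_zero_iff h2 (show discrim c₂ c₁ c₀ = δ * δ by
      rw [discrim, ← hδ, sq]) t
    rw [← this]
    ring_nf
  have hne : (-c₁ + δ) / (2 * c₂) ≠ (-c₁ - δ) / (2 * c₂) := by
    intro h
    field_simp at h
    exact hδ0 (by linear_combination h / 2)
  have hset : {b : K | c₂ * b ^ 4 + c₁ * b ^ 2 + c₀ = 0}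
      = {b : K | b ^ 2 ∈ ({(-c₁ + δ) / (2 * c₂), (-c₁ - δ) / (2 * c₂)} : Finset K)} := by
    ext b
    simp only [Set.mem_ofPred_eq, Finset.mem_insert, Finset.mem_singleton, ← hroot]
    ring_nf
  rw [hset, (ncard_setOf_sq_mem _).2, Finset.card_pair hne]
  simp only [Finset.mem_insert, Finset.mem_singleton, ← hroot]
  simpa using h0

end Counting

/-! ### The four pairs of squared coefficients -/

section Tangent

variable {K : Type*} [Field K] [CharZero K]

/-- The numerators of `A` and `B` are the common denominator with the parameters permuted, and `D`
is symmetric in them. -/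
theorem IsTangentPair.ne_zero {r s u A B : K} (hD : 4 - r ^ 2 - s ^ 2 - u ^ 2 + r * s * u ≠ 0)
    (h : IsTangentPair r s u A B) : A ≠ 0 ∧ B ≠ 0 := by
  obtain ⟨α, β, γ, hα, hβ, hγ, hA, hB⟩ := h
  constructor
  · rintro rfl
    rw [zero_mul] at hA
    exact sub_mul_ne_zero (r := s) (s := u) (u := r) hβ hγ
      (fun h ↦ hD (by linear_combination h)) hA.symm
  · rintro rfl
    rw [zero_mul] at hB
    exact sub_mul_ne_zero (r := u) (s := s) (u := r) hα hγ
      (fun h ↦ hD (by linear_combination h)) hB.symm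

theorem exists_finset_isTangentPair [IsAlgClosed K] {r s u : K} (hr : r ^ 2 - 4 ≠ 0)
    (hs : s ^ 2 - 4 ≠ 0) (hu : u ^ 2 - 4 ≠ 0)
    (hD : 4 - r ^ 2 - s ^ 2 - u ^ 2 + r * s * u ≠ 0) :
    ∃ T : Finset (K × K), T.card = 4 ∧ ∀ A B, (A, B) ∈ T ↔ IsTangentPair r s u A B := by
  classical
  obtain ⟨α, hα⟩ := IsAlgClosed.exists_pow_nat_eq (4 - s ^ 2) two_pos
  obtain ⟨β, hβ⟩ := IsAlgClosed.exists_pow_nat_eq (4 - u ^ 2) two_pos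
  obtain ⟨γ, hγ⟩ := IsAlgClosed.exists_pow_nat_eq (4 - r ^ 2) two_pos
  have hα0 : α ≠ 0 := by rintro rfl; exact hs (by linear_combination hα)
  have hβ0 : β ≠ 0 := by rintro rfl; exact hu (by linear_combination hβ)
  have hγ0 : γ ≠ 0 := by rintro rfl; exact hr (by linear_combination hγ)
  let P (x y z : K) : K × K := ((r * u - 2 * s - y * z) / (u * s - 2 * r - x * y),
    (r * s - 2 * u - x * z) / (u * s - 2 * r - x * y))
  have hP {x y z : K} (hx : x ^ 2 = 4 - s ^ 2) (hy : y ^ 2 = 4 - u ^ 2) (A B : K) :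
      (A, B) = P x y z ↔ A * (u * s - 2 * r - x * y) = r * u - 2 * s - y * z ∧
        B * (u * s - 2 * r - x * y) = r * s - 2 * u - x * z := by
    have := sub_mul_ne_zero hx hy hD
    rw [Prod.ext_iff, eq_div_iff this, eq_div_iff this]
  have hα' : (-α) ^ 2 = 4 - s ^ 2 := by rw [neg_sq, hα]
  have hβ' : (-β) ^ 2 = 4 - u ^ 2 := by rw [neg_sq, hβ]
  have hγ' : (-γ) ^ 2 = 4 - r ^ 2 := by rw [neg_sq, hγ]
  -- Two inequivalent sign choices agree in exactly one of the products `x y`, `y z`, `x z`. The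
  -- next three facts say that equal points agreeing in one product agree in a second, which
  -- separates the four points.
  have hfst {x y z x' y' z' : K} (hx : x ^ 2 = 4 - s ^ 2) (hy : y ^ 2 = 4 - u ^ 2)
      (hx' : x' ^ 2 = 4 - s ^ 2) (hy' : y' ^ 2 = 4 - u ^ 2) (hz : z ^ 2 = 4 - r ^ 2)
      (h : P x y z = P x' y' z') (hyz : y * z = y' * z') : x * y = x' * y' := by
    obtain ⟨h1, -⟩ := (hP hx' hy' _ _).1 h
    obtain ⟨h2, h3⟩ := (hP hx hy (P x y z).1 (P x y z).2).1 rfl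
    have h0 := (IsTangentPair.ne_zero hD ⟨x, y, z, hx, hy, hz, h2, h3⟩).1
    apply mul_left_cancel₀ h0
    linear_combination h1 - h2 + hyz
  have hsnd {x y z x' y' z' : K} (hx : x ^ 2 = 4 - s ^ 2) (hy : y ^ 2 = 4 - u ^ 2)
      (hx' : x' ^ 2 = 4 - s ^ 2) (hy' : y' ^ 2 = 4 - u ^ 2) (hz : z ^ 2 = 4 - r ^ 2)
      (h : P x y z = P x' y' z') (hyz : x * z = x' * z') : x * y = x' * y' := by
    obtain ⟨-, h1⟩ := (hP hx' hy' _ _).1 h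
    obtain ⟨h2, h3⟩ := (hP hx hy (P x y z).1 (P x y z).2).1 rfl
    have h0 := (IsTangentPair.ne_zero hD ⟨x, y, z, hx, hy, hz, h2, h3⟩).2
    apply mul_left_cancel₀ h0
    linear_combination h1 - h3 + hyz
  have hthd {x y z x' y' z' : K} (hx : x ^ 2 = 4 - s ^ 2) (hy : y ^ 2 = 4 - u ^ 2)
      (hx' : x' ^ 2 = 4 - s ^ 2) (hy' : y' ^ 2 = 4 - u ^ 2)
      (h : P x y z = P x' y' z') (hxy : x * y = x' * y') : x * z = x' * z' := by
    obtain ⟨-, h1⟩ := (hP hx' hy' _ _).1 h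
    obtain ⟨-, h3⟩ := (hP hx hy (P x y z).1 (P x y z).2).1 rfl
    linear_combination h3 - h1 + (P x y z).2 * hxy
  have hαβ : α * β ≠ 0 := mul_ne_zero hα0 hβ0
  have hαγ : α * γ ≠ 0 := mul_ne_zero hα0 hγ0
  -- Representatives of the eight sign choices modulo negating all three roots at once.
  refine ⟨{P α β γ, P (-α) β γ, P α (-β) γ, P α β (-γ)}, ?_, fun A B ↦ ?_⟩
  · rw [Finset.card_insert_of_notMem, Finset.card_insert_of_notMem, Finset.card_insert_of_notMem,
      Finset.card_singleton]
    · rw [Finset.mem_singleton]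
      intro h
      have := hfst hα hβ' hα hβ hγ h (by ring)
      exact hαβ (by linear_combination -this / 2)
    · simp only [Finset.mem_insert, Finset.mem_singleton]
      rintro (h | h)
      · have := hthd hα' hβ hα hβ' h (by ring)
        exact hαγ (by linear_combination -this / 2)
      · have := hsnd hα' hβ hα hβ hγ h (by ring)
        exact hαβ (by linear_combination -this / 2)
    · simp only [Finset.mem_insert, Finset.mem_singleton]
      rintro (h | h | h)
      · have := hfst hα hβ hα' hβ hγ h (by ring)
        exact hαβ (by linear_combination this / 2)
      · have := hsnd hα hβ hα hβ' hγ h (by ring)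
        exact hαβ (by linear_combination this / 2)
      · have := hthd hα hβ hα hβ h (by ring)
        exact hαγ (by linear_combination this / 2)
  · simp only [Finset.mem_insert, Finset.mem_singleton, hP hα hβ, hP hα' hβ, hP hα hβ']
    constructor
    · rintro (h | h | h | h)
      exacts [⟨α, β, γ, hα, hβ, hγ, h⟩, ⟨-α, β, γ, hα', hβ, hγ, h⟩, ⟨α, -β, γ, hα, hβ', hγ, h⟩,
        ⟨α, β, -γ, hα, hβ, hγ', h⟩]
    · rintro ⟨x, y, z, hx, hy, hz, h⟩
      rw [← hα, sq_eq_sq_iff_eq_or_eq_neg] at hx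
      rw [← hβ, sq_eq_sq_iff_eq_or_eq_neg] at hy
      rw [← hγ, sq_eq_sq_iff_eq_or_eq_neg] at hz
      rcases hx with rfl | rfl <;> rcases hy with rfl | rfl <;> rcases hz with rfl | rfl <;>
        simp only [neg_mul, mul_neg, neg_neg, sub_neg_eq_add] at h ⊢ <;>
        first | exact .inl h | exact .inr (.inl h) | exact .inr (.inr (.inl h)) |
          exact .inr (.inr (.inr h))

theorem bQuartic_eq_zero_iff [IsAlgClosed K] {r s u B : K}
    (hD : 4 - r ^ 2 - s ^ 2 - u ^ 2 + r * s * u ≠ 0) :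
    bQuartic r s u B = 0 ↔ ∃ A, IsTangentPair r s u A B := by
  constructor
  · intro h
    obtain ⟨α, hα⟩ := IsAlgClosed.exists_pow_nat_eq (4 - s ^ 2) two_pos
    obtain ⟨β, hβ⟩ := IsAlgClosed.exists_pow_nat_eq (4 - u ^ 2) two_pos
    obtain ⟨γ, hγ⟩ := IsAlgClosed.exists_pow_nat_eq (4 - r ^ 2) two_pos
    have hprod := bQuartic_eq_prod (t := B) hα hβ hγ
    rw [h, mul_zero] at hprod
    have key {y z : K} (hy : y ^ 2 = 4 - u ^ 2) (hz : z ^ 2 = 4 - r ^ 2)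
        (h : B * (u * s - 2 * r - α * y) - (r * s - 2 * u - α * z) = 0) :
        ∃ A, IsTangentPair r s u A B :=
      ⟨(r * u - 2 * s - y * z) / (u * s - 2 * r - α * y), α, y, z, hα, hy, hz,
        div_mul_cancel₀ _ (sub_mul_ne_zero hα hy hD), sub_eq_zero.1 h⟩
    have hβ' : (-β) ^ 2 = 4 - u ^ 2 := by rw [neg_sq, hβ]
    have hγ' : (-γ) ^ 2 = 4 - r ^ 2 := by rw [neg_sq, hγ]
    rcases mul_eq_zero.1 hprod with h | h
    · rcases mul_eq_zero.1 h with h | h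
      · rcases mul_eq_zero.1 h with h | h
        · exact key hβ hγ h
        · exact key hβ hγ' (by linear_combination h)
      · exact key hβ' hγ (by linear_combination h)
    · exact key hβ' hγ' (by linear_combination h)
  · rintro ⟨A, α, β, γ, hα, hβ, hγ, -, hB⟩
    have hprod := bQuartic_eq_prod (t := B) hα hβ hγ
    rw [sub_eq_zero.2 hB, zero_mul, zero_mul, zero_mul] at hprod
    simpa [hD] using hprod.symm

/-- If `r B = u`, clearing the denominator of `B` gives a linear relation in `α β` and `α γ`. The
product of its four sign conjugates is a multiple of `D` and of the two quantities assumed nonzero.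
-/
theorem IsTangentPair.mul_sub_ne_zero {r s u A B : K}
    (hD : 4 - r ^ 2 - s ^ 2 - u ^ 2 + r * s * u ≠ 0) (hru : r ^ 2 ≠ u ^ 2)
    (hD' : r ^ 2 + s ^ 2 + u ^ 2 + r * s * u ≠ 4) (h : IsTangentPair r s u A B) :
    r * B - u ≠ 0 := by
  obtain ⟨α, β, γ, hα, hβ, hγ, -, hB⟩ := h
  intro h0
  have h1 : s * (r ^ 2 - u ^ 2) - α * γ * r + α * β * u = 0 := by
    linear_combination (u * s - 2 * r - α * β) * h0 - r * hB
  have hnorm : (s * (r ^ 2 - u ^ 2) - α * γ * r + α * β * u)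
      * (s * (r ^ 2 - u ^ 2) + α * γ * r + α * β * u)
      * (s * (r ^ 2 - u ^ 2) - α * γ * r - α * β * u)
      * (s * (r ^ 2 - u ^ 2) + α * γ * r - α * β * u)
      = -16 * (r ^ 2 - u ^ 2) ^ 2 * (4 - r ^ 2 - s ^ 2 - u ^ 2 + r * s * u)
        * (r ^ 2 + s ^ 2 + u ^ 2 + r * s * u - 4) := by
    clear hB h0 h1
    obtain ⟨e, he⟩ : ∃ e, e = α * γ := ⟨_, rfl⟩
    obtain ⟨e', he'⟩ : ∃ e, e = α * β := ⟨_, rfl⟩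
    have h : e ^ 2 = (4 - s ^ 2) * (4 - r ^ 2) := by rw [he, mul_pow, hα, hγ]
    have h' : e' ^ 2 = (4 - s ^ 2) * (4 - u ^ 2) := by rw [he', mul_pow, hα, hβ]
    rw [← he, ← he']
    -- With `P = s(r² - u²)`, `Q = r e`, `V = u e'`, the product is `P⁴ - 2P²(Q² + V²) + (Q² -
    -- V²)²`; the two summands substitute for the squares in the last two terms.
    linear_combination -2 * (s * (r ^ 2 - u ^ 2)) ^ 2 * (r ^ 2 * h + u ^ 2 * h')
      + (r ^ 2 * e ^ 2 - u ^ 2 * e' ^ 2 + r ^ 2 * ((4 - s ^ 2) * (4 - r ^ 2))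
        - u ^ 2 * ((4 - s ^ 2) * (4 - u ^ 2))) * (r ^ 2 * h - u ^ 2 * h')
  rw [h1, zero_mul, zero_mul, zero_mul] at hnorm
  simp [hD, sub_ne_zero.2 hru, sub_ne_zero.2 hD'] at hnorm

theorem isBitangent_iff_isTangentPair [IsAlgClosed K] {r s u a b : K} (hu : u ^ 2 - 4 ≠ 0)
    (hD : 4 - r ^ 2 - s ^ 2 - u ^ 2 + r * s * u ≠ 0) (ha : a ≠ 0) (hb : b ≠ 0) :
    IsBitangent (quarticX4 r s u) ![a, b, 1] ↔ IsTangentPair r s u (a ^ 2) (b ^ 2) := by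
  rw [isBitangent_iff_isSquareRestriction hu]
  exact ⟨fun ⟨p, m, n, h⟩ ↦ h.isTangentPair ha hb, fun h ↦ h.exists_isSquareRestriction hD⟩

theorem nonzero_and_isBitangent_iff [IsAlgClosed K] {r s u a b : K} (hu : u ^ 2 - 4 ≠ 0)
    (hD : 4 - r ^ 2 - s ^ 2 - u ^ 2 + r * s * u ≠ 0) :
    (a ≠ 0 ∧ b ≠ 0 ∧ IsBitangent (quarticX4 r s u) ![a, b, 1]) ↔
      IsTangentPair r s u (a ^ 2) (b ^ 2) := by
  constructor
  · rintro ⟨ha, hb, h⟩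
    exact (isBitangent_iff_isTangentPair hu hD ha hb).1 h
  · intro h
    obtain ⟨ha, hb⟩ := h.ne_zero hD
    have ha' := (pow_ne_zero_iff two_ne_zero).1 ha
    have hb' := (pow_ne_zero_iff two_ne_zero).1 hb
    exact ⟨ha', hb', (isBitangent_iff_isTangentPair hu hD ha' hb').2 h⟩

end Tangent

/-! ### Expressibility by radicals -/

section Radicals

variable {F E : Type*} [Field F] [Field E] [Algebra F E]

theorem mem_solvableByRad_of_quadratic [CharZero E] {c₂ c₁ c₀ t : E}
    (h2 : c₂ ∈ solvableByRad F E) (h1 : c₁ ∈ solvableByRad F E) (h0 : c₀ ∈ solvableByRad F E)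
    (hc : c₂ ≠ 0) (h : c₂ * t ^ 2 + c₁ * t + c₀ = 0) : t ∈ solvableByRad F E := by
  have hδ : 2 * c₂ * t + c₁ ∈ solvableByRad F E := by
    refine solvableByRad.rad_mem two_ne_zero ?_
    rw [show (2 * c₂ * t + c₁) ^ 2 = c₁ ^ 2 - 4 * c₂ * c₀ by linear_combination 4 * c₂ * h]
    exact sub_mem (pow_mem h1 2) (mul_mem (mul_mem (ofNat_mem _ 4) h2) h0)
  rw [show t = (2 * c₂ * t + c₁ - c₁) / (2 * c₂) by field_simp; ring]
  exact div_mem (sub_mem hδ h1) (mul_mem (ofNat_mem _ 2) h2)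

theorem mem_solvableByRad_of_even_quartic [CharZero E] {c₂ c₁ c₀ b : E}
    (h2 : c₂ ∈ solvableByRad F E) (h1 : c₁ ∈ solvableByRad F E) (h0 : c₀ ∈ solvableByRad F E)
    (hc : c₂ ≠ 0) (h : c₂ * b ^ 4 + c₁ * b ^ 2 + c₀ = 0) : b ∈ solvableByRad F E :=
  solvableByRad.rad_mem two_ne_zero
    (mem_solvableByRad_of_quadratic h2 h1 h0 hc (by linear_combination h))

variable {K : Type*} [Field K] [CharZero K]

theorem mem_radicalField (r s u : K) :
    r ∈ radicalField r s u ∧ s ∈ radicalField r s u ∧ u ∈ radicalField r s u := by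
  have h {x : K} (hx : x ∈ ({r, s, u} : Set K)) : x ∈ radicalField r s u :=
    algebraMap_mem (radicalField r s u)
      (⟨x, IntermediateField.subset_adjoin ℚ _ hx⟩ : IntermediateField.adjoin ℚ {r, s, u})
  exact ⟨h (by simp), h (by simp), h (by simp)⟩

theorem IsTangentPair.mem_radicalField {r s u A B : K}
    (hD : 4 - r ^ 2 - s ^ 2 - u ^ 2 + r * s * u ≠ 0) (h : IsTangentPair r s u A B) :
    A ∈ radicalField r s u ∧ B ∈ radicalField r s u := by
  obtain ⟨hr, hs, hu⟩ := PlaneQuartic.mem_radicalField r s u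
  obtain ⟨α, β, γ, hα, hβ, hγ, hA, hB⟩ := h
  have hC := sub_mul_ne_zero hα hβ hD
  have h2 := ofNat_mem (radicalField r s u) 2
  have h4 := ofNat_mem (radicalField r s u) 4
  have mα : α ∈ radicalField r s u :=
    solvableByRad.rad_mem two_ne_zero (hα ▸ sub_mem h4 (pow_mem hs 2))
  have mβ : β ∈ radicalField r s u :=
    solvableByRad.rad_mem two_ne_zero (hβ ▸ sub_mem h4 (pow_mem hu 2))
  have mγ : γ ∈ radicalField r s u :=
    solvableByRad.rad_mem two_ne_zero (hγ ▸ sub_mem h4 (pow_mem hr 2))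
  have mC := sub_mem (sub_mem (mul_mem hu hs) (mul_mem h2 hr)) (mul_mem mα mβ)
  rw [← eq_div_iff hC] at hA hB
  rw [hA, hB]
  exact ⟨div_mem (sub_mem (sub_mem (mul_mem hr hu) (mul_mem h2 hs)) (mul_mem mβ mγ)) mC,
    div_mem (sub_mem (sub_mem (mul_mem hr hs) (mul_mem h2 hu)) (mul_mem mα mγ)) mC⟩

end Radicals

/-! ### Lines as points of the dual plane -/

section Lines

variable {K : Type*} [Field K]

theorem affine_ne_zero (p : K × K) : ![p.1, p.2, 1] ≠ 0 :=
  fun h ↦ one_ne_zero (α := K) (by simpa using congrFun h 2)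

theorem infinite_ne_zero (b : K) : ![1, b, 0] ≠ 0 :=
  fun h ↦ one_ne_zero (α := K) (by simpa using congrFun h 0)

theorem IsBitangent.mk_mem {f : MvPolynomial (Fin 3) K} {v : Fin 3 → K} (h : IsBitangent f v)
    (hv : v ≠ 0) : Projectivization.mk K v hv ∈ bitangents f :=
  ⟨v, h, rfl⟩

theorem mk_affine_injective :
    Function.Injective fun p : K × K ↦ Projectivization.mk K ![p.1, p.2, 1] (affine_ne_zero p) := by
  intro p q h
  obtain ⟨c, hc⟩ := (Projectivization.mk_eq_mk_iff' K _ _ _ _).1 h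
  have h0 := congrFun hc 0
  have h1 := congrFun hc 1
  obtain rfl : c = 1 := by simpa using congrFun hc 2
  simp at h0 h1
  exact Prod.ext h0.symm h1.symm

theorem mk_infinite_injective :
    Function.Injective fun b : K ↦ Projectivization.mk K ![1, b, 0] (infinite_ne_zero b) := by
  intro p q h
  obtain ⟨c, hc⟩ := (Projectivization.mk_eq_mk_iff' K _ _ _ _).1 h
  have h1 := congrFun hc 1
  obtain rfl : c = 1 := by simpa using congrFun hc 0
  simp at h1
  exact h1.symm

/-- Normalizing `c = 1`, or `a = 1` when `c = 0`, leaves only the line `y = 0`, on which the quartic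
is `x⁴ + u x² z² + z⁴`, not a square since `u² ≠ 4`. -/
theorem bitangents_eq [CharZero K] {r s u : K} (hu : u ^ 2 - 4 ≠ 0) :
    bitangents (quarticX4 r s u) =
      (fun p : K × K ↦ Projectivization.mk K ![p.1, p.2, 1] (affine_ne_zero p)) ''
          {p : K × K | IsBitangent (quarticX4 r s u) ![p.1, p.2, 1]} ∪
        (fun b : K ↦ Projectivization.mk K ![1, b, 0] (infinite_ne_zero b)) ''
          {b : K | IsBitangent (quarticX4 r s u) ![1, b, 0]} := by
  ext L
  constructor
  · rintro ⟨v, hv, rfl⟩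
    by_cases h2 : v 2 = 0
    · by_cases h0 : v 0 = 0
      · have h1 : v 1 ≠ 0 := fun h1 ↦ hv.1 (funext fun i ↦ by fin_cases i <;> simpa)
        have := hv.smul (inv_ne_zero h1)
        rw [show (v 1)⁻¹ • v = ![0, 1, 0] from
          funext fun i ↦ by fin_cases i <;> simp [h0, h1, h2]] at this
        exact absurd this (not_isBitangent_y hu)
      · have e : (v 0)⁻¹ • v = ![1, (v 0)⁻¹ * v 1, 0] :=
          funext fun i ↦ by fin_cases i <;> simp [h0, h2]
        refine .inr ⟨(v 0)⁻¹ * v 1, show IsBitangent _ _ from e ▸ hv.smul (inv_ne_zero h0), ?_⟩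
        exact (Projectivization.mk_eq_mk_iff' K _ _ _ _).2 ⟨(v 0)⁻¹, e⟩
    · have e : (v 2)⁻¹ • v = ![(v 2)⁻¹ * v 0, (v 2)⁻¹ * v 1, 1] :=
        funext fun i ↦ by fin_cases i <;> simp [h2]
      refine .inl ⟨((v 2)⁻¹ * v 0, (v 2)⁻¹ * v 1), show IsBitangent _ _ from e ▸ hv.smul (inv_ne_zero h2), ?_⟩
      exact (Projectivization.mk_eq_mk_iff' K _ _ _ _).2 ⟨(v 2)⁻¹, e⟩
  · rintro (⟨p, hp, rfl⟩ | ⟨b, hb, rfl⟩)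
    · exact IsBitangent.mk_mem hp _
    · exact IsBitangent.mk_mem hb _

theorem aQuadratic_sub (r s u b a a' : K) : aQuadratic r s u b a - aQuadratic r s u b a'
    = (s ^ 2 - 4) * (r * b ^ 2 - u) * (a ^ 2 - a' ^ 2) := by
  unfold aQuadratic; ring

end Lines

/-! ### The final counts -/

section Count

variable {K : Type*} [Field K] [CharZero K] [IsAlgClosed K] {r s u : K}

theorem ncard_isBitangent_left_zero (hr : r ^ 2 - 4 ≠ 0) (hu : u ^ 2 - 4 ≠ 0)
    (hD : 4 - r ^ 2 - s ^ 2 - u ^ 2 + r * s * u ≠ 0) :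
    {b : K | IsBitangent (quarticX4 r s u) ![0, b, 1]}.ncard = 4 := by
  simp_rw [isBitangent_left_zero_iff hu]
  exact ncard_setOf_even_quartic hu hr fun h ↦ hD (by linear_combination -h / 16)

theorem ncard_isBitangent_mid_zero (hr : r ^ 2 - 4 ≠ 0) (hs : s ^ 2 - 4 ≠ 0) (hu : u ^ 2 - 4 ≠ 0)
    (hD : 4 - r ^ 2 - s ^ 2 - u ^ 2 + r * s * u ≠ 0) :
    {a : K | IsBitangent (quarticX4 r s u) ![a, 0, 1]}.ncard = 4 := by
  simp_rw [isBitangent_mid_zero_iff hu]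
  exact ncard_setOf_even_quartic hs hr fun h ↦ hD (by linear_combination -h / 16)

theorem ncard_isBitangent_right_zero (hs : s ^ 2 - 4 ≠ 0) (hu : u ^ 2 - 4 ≠ 0)
    (hD : 4 - r ^ 2 - s ^ 2 - u ^ 2 + r * s * u ≠ 0) :
    {b : K | IsBitangent (quarticX4 r s u) ![1, b, 0]}.ncard = 4 := by
  simp_rw [isBitangent_right_zero_iff]
  exact ncard_setOf_even_quartic hu hs fun h ↦ hD (by linear_combination -h / 16)

theorem ncard_isBitangent_nonzero (hr : r ^ 2 - 4 ≠ 0) (hs : s ^ 2 - 4 ≠ 0) (hu : u ^ 2 - 4 ≠ 0)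
    (hD : 4 - r ^ 2 - s ^ 2 - u ^ 2 + r * s * u ≠ 0) :
    {p : K × K | p.1 ≠ 0 ∧ p.2 ≠ 0 ∧
      IsBitangent (quarticX4 r s u) ![p.1, p.2, 1]}.ncard = 16 := by
  obtain ⟨T, hT, hmem⟩ := exists_finset_isTangentPair hr hs hu hD
  simp_rw [nonzero_and_isBitangent_iff hu hD, ← hmem]
  rw [(ncard_setOf_sq_prod_mem fun t ht ↦ ((hmem t.1 t.2).1 ht).ne_zero hD).2, hT]

theorem ncard_isBitangent_affine (hr : r ^ 2 - 4 ≠ 0) (hs : s ^ 2 - 4 ≠ 0) (hu : u ^ 2 - 4 ≠ 0)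
    (hD : 4 - r ^ 2 - s ^ 2 - u ^ 2 + r * s * u ≠ 0) :
    {p : K × K | IsBitangent (quarticX4 r s u) ![p.1, p.2, 1]}.ncard = 24 := by
  have h16 := ncard_isBitangent_nonzero hr hs hu hD
  have hb := ncard_isBitangent_left_zero hr hu hD
  have ha := ncard_isBitangent_mid_zero hr hs hu hD
  have hset : {p : K × K | IsBitangent (quarticX4 r s u) ![p.1, p.2, 1]} =
      {p : K × K | p.1 ≠ 0 ∧ p.2 ≠ 0 ∧ IsBitangent (quarticX4 r s u) ![p.1, p.2, 1]} ∪
        (Prod.mk 0 '' {b : K | IsBitangent (quarticX4 r s u) ![0, b, 1]} ∪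
          (fun a ↦ (a, 0)) '' {a : K | IsBitangent (quarticX4 r s u) ![a, 0, 1]}) := by
    ext ⟨a, b⟩
    by_cases ha : a = 0
    · subst ha
      by_cases hb : b = 0
      · subst hb; simp
      · simp [Ne.symm hb]
    · by_cases hb : b = 0
      · subst hb; simp [ha, Ne.symm ha]
      · simp [ha, hb, Ne.symm ha, Ne.symm hb]
  have f16 := Set.finite_of_ncard_ne_zero (h16.trans_ne (by simp))
  have fb := (Set.finite_of_ncard_ne_zero (hb.trans_ne (by simp))).image (Prod.mk (0 : K))
  have fa := (Set.finite_of_ncard_ne_zero (ha.trans_ne (by simp))).image fun a : K ↦ (a, (0 : K))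
  rw [hset, Set.ncard_union_eq ?_ f16 (fb.union fa), Set.ncard_union_eq ?_ fb fa,
    Set.ncard_image_of_injective _ (Prod.mk_right_injective 0),
    Set.ncard_image_of_injective _ (Prod.mk_left_injective 0), h16, ha, hb]
  · rw [Set.disjoint_left]
    rintro _ ⟨b, hb, rfl⟩ ⟨a, ha, h⟩
    obtain ⟨rfl, -⟩ : a = 0 ∧ 0 = b := Prod.ext_iff.1 h
    have h := (isBitangent_mid_zero_iff hu).1 ha
    -- The families `a = 0` and `b = 0` could only share the line `z = 0`, which is a bitangent only
    -- if `r² = 4`.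
    exact hr (by linear_combination h)
  · rw [Set.disjoint_left]
    rintro _ ⟨h1, h2, -⟩ (⟨b, hb, rfl⟩ | ⟨a, ha, rfl⟩)
    · exact h1 rfl
    · exact h2 rfl

theorem ncard_bitangents (hr : r ^ 2 - 4 ≠ 0) (hs : s ^ 2 - 4 ≠ 0) (hu : u ^ 2 - 4 ≠ 0)
    (hD : 4 - r ^ 2 - s ^ 2 - u ^ 2 + r * s * u ≠ 0) :
    (bitangents (quarticX4 r s u)).ncard = 28 := by
  have h24 := ncard_isBitangent_affine hr hs hu hD
  have h4 := ncard_isBitangent_right_zero hs hu hD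
  have f24 := (Set.finite_of_ncard_ne_zero (h24.trans_ne (by simp))).image
    fun p : K × K ↦ Projectivization.mk K ![p.1, p.2, 1] (affine_ne_zero p)
  have f4 := (Set.finite_of_ncard_ne_zero (h4.trans_ne (by simp))).image
    fun b : K ↦ Projectivization.mk K ![1, b, 0] (infinite_ne_zero b)
  rw [bitangents_eq hu, Set.ncard_union_eq ?_ f24 f4,
    Set.ncard_image_of_injective _ mk_affine_injective,
    Set.ncard_image_of_injective _ mk_infinite_injective, h24, h4]
  rw [Set.disjoint_left]
  rintro _ ⟨p, -, rfl⟩ ⟨b, -, h⟩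
  obtain ⟨c, hc⟩ := (Projectivization.mk_eq_mk_iff' K _ _ _ _).1 h
  obtain rfl : c = 0 := by simpa using congrFun hc 2
  simpa using congrFun hc 0

theorem exists_mem_radicalField (hs : s ^ 2 - 4 ≠ 0) (hu : u ^ 2 - 4 ≠ 0)
    (hD : 4 - r ^ 2 - s ^ 2 - u ^ 2 + r * s * u ≠ 0) {L : ℙ K (Fin 3 → K)}
    (hL : L ∈ bitangents (quarticX4 r s u)) :
    ∃ a ∈ radicalField r s u, ∃ b ∈ radicalField r s u, ∃ c ∈ radicalField r s u,
      ∃ h : ![a, b, c] ≠ 0, L = Projectivization.mk K ![a, b, c] h := by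
  obtain ⟨mr, ms, mu⟩ := mem_radicalField r s u
  have m0 := zero_mem (radicalField r s u)
  have m1 := one_mem (radicalField r s u)
  have m2 := ofNat_mem (radicalField r s u) 2
  have m4 := ofNat_mem (radicalField r s u) 4
  have mr4 := sub_mem (pow_mem mr 2) m4
  have ms4 := sub_mem (pow_mem ms 2) m4
  have mu4 := sub_mem (pow_mem mu 2) m4
  rw [bitangents_eq hu] at hL
  rcases hL with ⟨⟨a, b⟩, hp, rfl⟩ | ⟨b, hb, rfl⟩
  · replace hp : IsBitangent (quarticX4 r s u) ![a, b, 1] := hp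
    suffices h : a ∈ radicalField r s u ∧ b ∈ radicalField r s u from
      ⟨a, h.1, b, h.2, 1, m1, _, rfl⟩
    by_cases ha : a = 0
    · subst ha
      exact ⟨m0, mem_solvableByRad_of_even_quartic mu4
        (sub_mem (mul_mem (mul_mem m2 mr) mu) (mul_mem m4 ms)) mr4 hu
        ((isBitangent_left_zero_iff hu).1 hp)⟩
    by_cases hb : b = 0
    · subst hb
      exact ⟨mem_solvableByRad_of_even_quartic ms4
        (sub_mem (mul_mem (mul_mem m2 mr) ms) (mul_mem m4 mu)) mr4 hs
        ((isBitangent_mid_zero_iff hu).1 hp), m0⟩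
    have h := ((isBitangent_iff_isTangentPair hu hD ha hb).1 hp).mem_radicalField hD
    exact ⟨solvableByRad.rad_mem two_ne_zero h.1, solvableByRad.rad_mem two_ne_zero h.2⟩
  · exact ⟨1, m1, b, mem_solvableByRad_of_even_quartic mu4
      (sub_mem (mul_mem (mul_mem m2 ms) mu) (mul_mem m4 mr)) ms4 hu
      (isBitangent_right_zero_iff.1 hb), 0, m0, _, rfl⟩

theorem exists_isBitangent_iff_bQuartic (hu : u ^ 2 - 4 ≠ 0)
    (hD : 4 - r ^ 2 - s ^ 2 - u ^ 2 + r * s * u ≠ 0) (b : K) :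
    (∃ a : K, a ≠ 0 ∧ b ≠ 0 ∧ IsBitangent (quarticX4 r s u) ![a, b, 1]) ↔
      bQuartic r s u (b ^ 2) = 0 := by
  simp_rw [nonzero_and_isBitangent_iff hu hD, bQuartic_eq_zero_iff hD]
  constructor
  · rintro ⟨a, h⟩
    exact ⟨a ^ 2, h⟩
  · rintro ⟨A, h⟩
    obtain ⟨a, rfl⟩ := IsAlgClosed.exists_pow_nat_eq A two_pos
    exact ⟨a, h⟩

theorem isTangentPair_unique {A A' B : K} (hs : s ^ 2 - 4 ≠ 0)
    (hD : 4 - r ^ 2 - s ^ 2 - u ^ 2 + r * s * u ≠ 0) (hB : r * B - u ≠ 0)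
    (h : IsTangentPair r s u A B) (h' : IsTangentPair r s u A' B) : A = A' := by
  obtain ⟨a, rfl⟩ := IsAlgClosed.exists_pow_nat_eq A two_pos
  obtain ⟨a', rfl⟩ := IsAlgClosed.exists_pow_nat_eq A' two_pos
  obtain ⟨b, rfl⟩ := IsAlgClosed.exists_pow_nat_eq B two_pos
  have := aQuadratic_sub r s u b a a'
  rw [aQuadratic_eq_zero_of_isTangentPair hD h, aQuadratic_eq_zero_of_isTangentPair hD h',
    sub_zero] at this
  simpa [hs, hB, sub_eq_zero] using this.symm

theorem aQuadratic_eq_zero_iff (hs : s ^ 2 - 4 ≠ 0) (hu : u ^ 2 - 4 ≠ 0)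
    (hD : 4 - r ^ 2 - s ^ 2 - u ^ 2 + r * s * u ≠ 0) {b : K} (hb : bQuartic r s u (b ^ 2) = 0)
    (hrb : r * b ^ 2 - u ≠ 0) :
    (∀ a : K, (a ≠ 0 ∧ IsBitangent (quarticX4 r s u) ![a, b, 1]) ↔ aQuadratic r s u b a = 0) ∧
      {a : K | aQuadratic r s u b a = 0}.ncard = 2 := by
  obtain ⟨c, hc⟩ := (exists_isBitangent_iff_bQuartic hu hD b).2 hb
  have hb0 : b ≠ 0 := hc.2.1
  have ht := (nonzero_and_isBitangent_iff hu hD).1 hc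
  have hroot (a : K) : aQuadratic r s u b a = 0 ↔ a ^ 2 = c ^ 2 := by
    have := aQuadratic_sub r s u b a c
    rw [aQuadratic_eq_zero_of_isTangentPair hD ht, sub_zero] at this
    rw [this]
    simp [hs, hrb, sub_eq_zero]
  constructor
  · intro a
    have hiff := nonzero_and_isBitangent_iff (r := r) (s := s) (a := a) (b := b) hu hD
    rw [hroot]
    constructor
    · rintro ⟨ha, h⟩
      exact (hroot a).1 (aQuadratic_eq_zero_of_isTangentPair hD (hiff.1 ⟨ha, hb0, h⟩))
    · intro h
      have := hiff.2 (h ▸ ht)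
      exact ⟨this.1, this.2.2⟩
  · simp_rw [hroot]
    exact (setOf_sq_eq (ht.ne_zero hD).1).2

/-- Since `r B ≠ u`, the four pairs have distinct second entries. These are nonzero because the
constant term of the quartic is `D`, so each has two square roots. -/
theorem ncard_bQuartic_roots (hr : r ^ 2 - 4 ≠ 0) (hs : s ^ 2 - 4 ≠ 0) (hu : u ^ 2 - 4 ≠ 0)
    (hD : 4 - r ^ 2 - s ^ 2 - u ^ 2 + r * s * u ≠ 0) (hru : r ^ 2 ≠ u ^ 2)
    (hD' : r ^ 2 + s ^ 2 + u ^ 2 + r * s * u ≠ 4) :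
    {b : K | bQuartic r s u (b ^ 2) = 0}.ncard = 8 := by
  classical
  obtain ⟨T, hT, hmem⟩ := exists_finset_isTangentPair hr hs hu hD
  have hroot (B : K) : bQuartic r s u B = 0 ↔ B ∈ T.image Prod.snd := by
    simp [bQuartic_eq_zero_iff hD, hmem]
  have hinj : Set.InjOn Prod.snd (T : Set (K × K)) := by
    rintro ⟨A, B⟩ h ⟨A', B'⟩ h' hB
    obtain rfl : B = B' := hB
    have t := (hmem _ _).1 h
    rw [isTangentPair_unique hs hD (t.mul_sub_ne_zero hD hru hD') t ((hmem _ _).1 h')]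
  simp_rw [hroot]
  rw [(ncard_setOf_sq_mem _).2, Finset.card_image_of_injOn hinj, hT]
  rw [← hroot]
  simpa [bQuartic] using hD

end Count

end PlaneQuartic

open PlaneQuartic in
theorem theorem1 {K : Type*} [Field K] [CharZero K] [IsAlgClosed K] (r s u : K)
    (hsmooth : IsSmoothCurve (quarticX4 r s u)) :
    -- there are 28 bitangents, and all of them are expressible by radicals over `ℚ(r, s, u)`
    (bitangents (quarticX4 r s u)).ncard = 28 ∧
    (∀ L ∈ bitangents (quarticX4 r s u),
      ∃ a ∈ radicalField r s u, ∃ b ∈ radicalField r s u, ∃ c ∈ radicalField r s u,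
        ∃ h : ![a, b, c] ≠ 0, L = Projectivization.mk K ![a, b, c] h) ∧
    -- 24 bitangents have an equation `a x + b y + z = 0`
    {p : K × K | IsBitangent (quarticX4 r s u) ![p.1, p.2, 1]}.ncard = 24 ∧
    -- four bitangents `b y + z = 0`, given by an even quartic in `b`
    (u ^ 2 - 4 ≠ 0 ∧
      (∀ b : K, IsBitangent (quarticX4 r s u) ![0, b, 1] ↔
        (u ^ 2 - 4) * b ^ 4 + (2 * r * u - 4 * s) * b ^ 2 + (r ^ 2 - 4) = 0) ∧
      {b : K | IsBitangent (quarticX4 r s u) ![0, b, 1]}.ncard = 4) ∧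
    -- four bitangents `a x + z = 0`, given by an even quartic in `a`
    (s ^ 2 - 4 ≠ 0 ∧
      (∀ a : K, IsBitangent (quarticX4 r s u) ![a, 0, 1] ↔
        (s ^ 2 - 4) * a ^ 4 + (2 * r * s - 4 * u) * a ^ 2 + (r ^ 2 - 4) = 0) ∧
      {a : K | IsBitangent (quarticX4 r s u) ![a, 0, 1]}.ncard = 4) ∧
    -- four bitangents `x + b y = 0`, outside the chart `c = 1`
    ((∀ b : K, IsBitangent (quarticX4 r s u) ![1, b, 0] ↔
        (u ^ 2 - 4) * b ^ 4 + (2 * s * u - 4 * r) * b ^ 2 + (s ^ 2 - 4) = 0) ∧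
      {b : K | IsBitangent (quarticX4 r s u) ![1, b, 0]}.ncard = 4) ∧
    -- the remaining sixteen bitangents `a x + b y + z = 0` with `a b ≠ 0`
    {p : K × K | p.1 ≠ 0 ∧ p.2 ≠ 0 ∧
      IsBitangent (quarticX4 r s u) ![p.1, p.2, 1]}.ncard = 16 ∧
    -- their `b` are the roots of an even polynomial of degree 8, a quartic in `b ^ 2`
    4 - r ^ 2 - s ^ 2 - u ^ 2 + r * s * u ≠ 0 ∧
    (∀ b : K, (∃ a : K, a ≠ 0 ∧ b ≠ 0 ∧ IsBitangent (quarticX4 r s u) ![a, b, 1]) ↔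
      bQuartic r s u (b ^ 2) = 0) ∧
    -- their `a` satisfy a quadratic equation over `b`, which determines them if it is not trivial
    (∀ a b : K, a ≠ 0 → b ≠ 0 → IsBitangent (quarticX4 r s u) ![a, b, 1] →
      aQuadratic r s u b a = 0) ∧
    (∀ b : K, bQuartic r s u (b ^ 2) = 0 → r * b ^ 2 - u ≠ 0 →
      (∀ a : K, (a ≠ 0 ∧ IsBitangent (quarticX4 r s u) ![a, b, 1]) ↔ aQuadratic r s u b a = 0) ∧
      {a : K | aQuadratic r s u b a = 0}.ncard = 2) ∧
    -- for general parameters there are eight values of `b`, each with a pair of values of `a`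
    (r ^ 2 ≠ u ^ 2 → r ^ 2 + s ^ 2 + u ^ 2 + r * s * u ≠ 4 →
      {b : K | bQuartic r s u (b ^ 2) = 0}.ncard = 8 ∧
      ∀ b : K, bQuartic r s u (b ^ 2) = 0 → r * b ^ 2 - u ≠ 0) := by
  obtain ⟨hr, hs, hu, hD⟩ := nondegenerate_of_isSmoothCurve hsmooth
  refine ⟨ncard_bitangents hr hs hu hD, fun L hL ↦ exists_mem_radicalField hs hu hD hL,
    ncard_isBitangent_affine hr hs hu hD,
    ⟨hu, fun b ↦ isBitangent_left_zero_iff hu, ncard_isBitangent_left_zero hr hu hD⟩,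
    ⟨hs, fun a ↦ isBitangent_mid_zero_iff hu, ncard_isBitangent_mid_zero hr hs hu hD⟩,
    ⟨fun b ↦ isBitangent_right_zero_iff, ncard_isBitangent_right_zero hs hu hD⟩,
    ncard_isBitangent_nonzero hr hs hu hD, hD, exists_isBitangent_iff_bQuartic hu hD, ?_,
    fun b hb hrb ↦ aQuadratic_eq_zero_iff hs hu hD hb hrb,
    fun hru hD' ↦ ⟨ncard_bQuartic_roots hr hs hu hD hru hD', fun b hb ↦ ?_⟩⟩
  · intro a b ha hb h
    exact aQuadratic_eq_zero_of_isTangentPair hD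
      ((isBitangent_iff_isTangentPair hu hD ha hb).1 h)
  · obtain ⟨A, hA⟩ := (bQuartic_eq_zero_iff hD).1 hb
    exact hA.mul_sub_ne_zero hD hru hD'
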